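/- Let $P$ be a simple polygon in the plane, with boundary $\partial P$ and interior $\mathrm{int}(P)$ (the open region enclosed by $\partial P$). An \emph{edge} of $P$ is the segment between two consecutive vertices; a \emph{diagonal} of $P$ is a segment $\overline{rs}$ between two non-consecutive vertices $r,s$ such that $\overline{rs}\setminus\{r,s\}\subseteq \mathrm{int}(P)$. An \emph{open mobile guard} of $P$ is an edge or a diagonal of $P$ without its two endpoints. A guard $g$ \emph{sees} a point $l\in\mathrm{int}(P)$ if there is a point $p\in g$ such that the interior of the segment $\overline{lp}$ lies in $\mathrm{int}(P)$. Two guards $g_1,g_2$ \emph{see each other} if there are points $p\in g_1$ and $q\in g_2$ such that $\overline{pq}\setminus\{p,q\}\subseteq\mathrm{int}(P)$. A \emph{hidden open mobile guard set} of $P$ is a set $S$ of open mobile guards of $P$ such that every point of $\mathrm{int}(P)$ is seen by at least one guard in $S$ and no two different guards in $S$ see each other. \textbf{Lemma.} There exists a simple polygon (with no three consecutive vertices collinear) that does not admit a hidden open mobile guard set. -/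

import Mathlib

/-- The Euclidean plane. -/
abbrev Plane : Type := EuclideanSpace ℝ (Fin 2)

namespace Polygon

variable {n : ℕ}

/-- `P` is a simple polygon: any three consecutive vertices are affinely independent (so there are
at least three vertices and every vertex is a genuine corner), distinct indices give distinct
vertices, and two different edges meet at most in a common endpoint. -/
structure IsSimple [NeZero n] (P : Polygon Plane n) : Prop where
  corners : P.HasNondegenerateVertices ℝ
  injective : Function.Injective P.vertices
  inter_subset : ∀ i j : Fin n, i ≠ j →
    P.edgeSet ℝ i ∩ P.edgeSet ℝ j ⊆ {P i, P (i + 1)} ∩ {P j, P (j + 1)}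

/-- The open region enclosed by the boundary of `P`: the points off the boundary whose connected
component in the complement of the boundary is bounded. -/
def inside (P : Polygon Plane n) : Set Plane :=
  {x | x ∉ P.boundary ℝ ∧ Bornology.IsBounded (connectedComponentIn (P.boundary ℝ)ᶜ x)}

/-- `g` is an edge of `P` without its two endpoints. -/
def IsOpenEdge [NeZero n] (P : Polygon Plane n) (g : Set Plane) : Prop :=
  ∃ i : Fin n, g = openSegment ℝ (P i) (P (i + 1))

/-- `g` is a diagonal of `P` without its two endpoints: the open segment between two
non-consecutive vertices, provided that it lies in the interior of `P`. -/
def IsOpenDiagonal [NeZero n] (P : Polygon Plane n) (g : Set Plane) : Prop :=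
  ∃ i j : Fin n, i ≠ j ∧ j ≠ i + 1 ∧ i ≠ j + 1 ∧
    g = openSegment ℝ (P i) (P j) ∧ openSegment ℝ (P i) (P j) ⊆ P.inside

/-- An open mobile guard of `P`: an open edge or an open diagonal. -/
def IsOpenMobileGuard [NeZero n] (P : Polygon Plane n) (g : Set Plane) : Prop :=
  P.IsOpenEdge g ∨ P.IsOpenDiagonal g

/-- The guard `g` sees the location `x`: the open segment from `x` to some point of `g` lies in the
interior of `P`. -/
def Sees (P : Polygon Plane n) (g : Set Plane) (x : Plane) : Prop :=
  ∃ p ∈ g, openSegment ℝ x p ⊆ P.inside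

/-- The guards `g` and `h` see each other: some segment from a point of `g` to a point of `h` lies
in the interior of `P` apart from its endpoints. -/
def SeeEachOther (P : Polygon Plane n) (g h : Set Plane) : Prop :=
  ∃ p ∈ g, ∃ q ∈ h, segment ℝ p q \ {p, q} ⊆ P.inside

/-- `S` is a hidden open mobile guard set of `P`: a set of open edges and open diagonals such that
every point of the interior of `P` is seen by a member of `S`, and no two different members of `S`
see each other. -/
structure IsHiddenOpenMobileGuardSet [NeZero n] (P : Polygon Plane n) (S : Set (Set Plane)) :
    Prop where
  guards : ∀ g ∈ S, P.IsOpenMobileGuard g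
  covers : ∀ x ∈ P.inside, ∃ g ∈ S, P.Sees g x
  hidden : ∀ g ∈ S, ∀ h ∈ S, g ≠ h → ¬ P.SeeEachOther g h

end Polygon

/-! The witness is an explicit lattice polygon with six narrow spikes. A point near the tip of a
spike can be seen only by guards from a list of sixteen, so a hidden guard set would contain a
member of each of the six lists. Whichever members are taken, two of them see each other. That is a
finite search (`refutes_sound`), and it needs only one-sided, sufficient tests, all expressed by
signs of orientations of lattice points.

Negative visibility needs no knowledge of the interior: a sight line that meets an edge leaves it
(`Shields.inter_nonempty`). Positive visibility does, since `inside` is defined through bounded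
components. For this a list of triangles is given whose sides are edges of the polygon or are glued
in pairs. The frontier of their union lies in the boundary, so a connected set off the boundary that
meets the union stays in it (`subset_triangles`) and hence lies in a bounded component. Neither
disjointness of the triangles nor the converse inclusion is needed. -/

/-! ### Orientation of triples of points -/

/-- Twice the signed area of the triangle `a b c`. -/
def orient (a b c : Plane) : ℝ :=
  (b 0 - a 0) * (c 1 - a 1) - (b 1 - a 1) * (c 0 - a 0)

theorem orient_rotate (a b c : Plane) : orient b c a = orient a b c := by
  unfold orient; ring

theorem orient_swap (a b c : Plane) : orient b a c = -orient a b c := by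
  unfold orient; ring

theorem orient_self_left (a b : Plane) : orient a b a = 0 := by
  unfold orient; ring

theorem orient_self_right (a b : Plane) : orient a b b = 0 := by
  unfold orient; ring

theorem orient_combo (a b u w : Plane) {s t : ℝ} (h : s + t = 1) :
    orient a b (s • u + t • w) = s * orient a b u + t * orient a b w := by
  obtain rfl : s = 1 - t := by linarith
  simp only [orient, PiLp.add_apply, PiLp.smul_apply, smul_eq_mul]
  ring

theorem orient_combo_mid (x u p q : Plane) {s t : ℝ} (h : s + t = 1) :
    orient x (s • p + t • q) u = s * orient x p u + t * orient x q u := by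
  obtain rfl : s = 1 - t := by linarith
  simp only [orient, PiLp.add_apply, PiLp.smul_apply, smul_eq_mul]
  ring

theorem continuous_orient (a b : Plane) : Continuous (orient a b) := by
  unfold orient; fun_prop

theorem Plane.ext_coord {p q : Plane} (h0 : p 0 = q 0) (h1 : p 1 = q 1) : p = q := by
  ext i; fin_cases i
  · exact h0
  · exact h1

theorem affineIndependent_of_orient_ne_zero {a b c : Plane} (h : orient a b c ≠ 0) :
    AffineIndependent ℝ ![a, b, c] := by
  rw [affineIndependent_iff_linearIndependent_vsub ℝ _ (0 : Fin 3),
    ← linearIndependent_equiv (finSuccAboveEquiv (0 : Fin 3))]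
  have : (fun i : {x // x ≠ (0 : Fin 3)} => (![a, b, c] i -ᵥ ![a, b, c] 0 : Plane)) ∘
      (finSuccAboveEquiv (0 : Fin 3)) = ![b - a, c - a] := by
    funext i; fin_cases i <;> rfl
  rw [this, LinearIndependent.pair_iff]
  intro s t hst
  have h0 := congrArg (fun v : Plane => v 0) hst
  have h1 := congrArg (fun v : Plane => v 1) hst
  simp only [PiLp.add_apply, PiLp.smul_apply, PiLp.sub_apply, smul_eq_mul, PiLp.zero_apply]
    at h0 h1
  have e1 : s * orient a b c = 0 := by
    unfold orient; linear_combination (c 1 - a 1) * h0 - (c 0 - a 0) * h1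
  have e2 : t * orient a b c = 0 := by
    unfold orient; linear_combination (b 0 - a 0) * h1 - (b 1 - a 1) * h0
  exact ⟨(mul_eq_zero.1 e1).resolve_right h, (mul_eq_zero.1 e2).resolve_right h⟩

/-- If the line through `u` and `w` separates `x` from `p` and the line through `x` and `p` weakly
separates `u` from `w`, then the two segments cross. -/
theorem exists_mem_openSegment_inter_segment {x p u w : Plane} (hx : 0 < orient u w x)
    (hp : orient u w p < 0) (hu : orient x p u ≤ 0) (hw : 0 ≤ orient x p w) :
    (openSegment ℝ x p ∩ segment ℝ u w).Nonempty := by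
  set α := orient u w x with hα
  set β := orient u w p with hβ
  set γ := orient x p w with hγ
  set δ := orient x p u with hδ
  have hsum : γ - δ = α - β := by
    simp only [hα, hβ, hγ, hδ, orient]; ring
  have hpos : 0 < α - β := by linarith
  -- The weights `-β : α` give the zero of `orient u w` on the line `x p`; the weights `γ : -δ` give
  -- the zero of `orient x p` on the line `u w`. By `hsum` both have the same total, and they
  -- describe the same point.
  refine ⟨(-β / (α - β)) • x + (α / (α - β)) • p,
    ⟨-β / (α - β), α / (α - β), div_pos (by linarith) hpos, div_pos hx hpos, ?_, rfl⟩,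
    ⟨γ / (α - β), -δ / (α - β), div_nonneg hw hpos.le, div_nonneg (by linarith) hpos.le, ?_, ?_⟩⟩
  · field_simp; ring
  · rw [← hsum]; have := hpos.ne'; rw [← hsum] at this; field_simp; ring
  · have hne := hpos.ne'
    refine Plane.ext_coord ?_ ?_ <;>
    · simp only [PiLp.add_apply, PiLp.smul_apply, smul_eq_mul]
      field_simp
      simp only [hα, hβ, hγ, hδ, orient]
      ring

/-- A point of the line through `a` and `b` which lies strictly on the inner side of the two other
sides of the triangle `a b c` lies between `a` and `b`. -/
theorem mem_segment_of_orient {a b c q : Plane} (h : 0 < orient a b c) (hab : orient a b q = 0)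
    (hbc : 0 ≤ orient b c q) (hca : 0 ≤ orient c a q) : q ∈ segment ℝ a b := by
  have hsum : orient b c q + orient c a q = orient a b c := by
    have : orient a b q + orient b c q + orient c a q = orient a b c := by unfold orient; ring
    linarith
  have hne := h.ne'
  refine ⟨orient b c q / orient a b c, orient c a q / orient a b c, div_nonneg hbc h.le,
    div_nonneg hca h.le, ?_, ?_⟩
  · rw [← add_div, hsum, div_self hne]
  · refine Plane.ext_coord ?_ ?_ <;> simp only [PiLp.add_apply, PiLp.smul_apply, smul_eq_mul]
    · field_simp
      unfold orient at hab ⊢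
      linear_combination (-c 0) * hab
    · field_simp
      unfold orient at hab ⊢
      linear_combination (-c 1) * hab

/-! ### Closed triangles -/

/-- The closed triangle bounded by the three lines through the counterclockwise triple `a b c`. -/
def closedTriangle (a b c : Plane) : Set Plane :=
  {x | 0 ≤ orient a b x ∧ 0 ≤ orient b c x ∧ 0 ≤ orient c a x}

theorem isClosed_closedTriangle (a b c : Plane) : IsClosed (closedTriangle a b c) :=
  (isClosed_le continuous_const (continuous_orient a b)).inter
    ((isClosed_le continuous_const (continuous_orient b c)).inter
      (isClosed_le continuous_const (continuous_orient c a)))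

theorem closedTriangle_rotate (a b c : Plane) : closedTriangle b c a = closedTriangle a b c := by
  ext x; simp only [closedTriangle, Set.mem_ofPred_eq]; tauto

/-- Barycentric coordinates: the three orientations, divided by their sum `orient a b c`, are
weights in `[0, 1]`. -/
theorem isBounded_closedTriangle {a b c : Plane} (h : 0 < orient a b c) :
    Bornology.IsBounded (closedTriangle a b c) := by
  refine (Metric.isBounded_closedBall (x := (0 : Plane)) (r := ‖a‖ + ‖b‖ + ‖c‖)).subset ?_
  rintro x ⟨h1, h2, h3⟩
  rw [mem_closedBall_zero_iff]
  have hne := h.ne'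
  have hsum : orient a b x + orient b c x + orient c a x = orient a b c := by unfold orient; ring
  have hx : x = (orient b c x / orient a b c) • a + (orient c a x / orient a b c) • b
      + (orient a b x / orient a b c) • c := by
    refine Plane.ext_coord ?_ ?_ <;>
    · simp only [PiLp.add_apply, PiLp.smul_apply, smul_eq_mul]
      field_simp
      unfold orient
      ring
  have key : ∀ {t : ℝ} (v : Plane), 0 ≤ t → t ≤ orient a b c →
      ‖(t / orient a b c) • v‖ ≤ ‖v‖ := by
    intro t v h0 h1
    rw [norm_smul, Real.norm_of_nonneg (div_nonneg h0 h.le)]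
    exact mul_le_of_le_one_left (norm_nonneg v) ((div_le_one h).2 h1)
  calc ‖x‖ = _ := congrArg norm hx
    _ ≤ _ := norm_add₃_le
    _ ≤ _ := add_le_add (add_le_add (key a h2 (by linarith)) (key b h3 (by linarith)))
      (key c h1 (by linarith))

theorem closedTriangle_mem_nhds {a b c q : Plane} (h1 : 0 < orient a b q) (h2 : 0 < orient b c q)
    (h3 : 0 < orient c a q) : closedTriangle a b c ∈ nhds q := by
  filter_upwards [(continuous_orient a b).continuousAt.eventually_const_lt h1,
    (continuous_orient b c).continuousAt.eventually_const_lt h2,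
    (continuous_orient c a).continuousAt.eventually_const_lt h3] with x h1 h2 h3
  exact ⟨h1.le, h2.le, h3.le⟩

/-- Two triangles on different sides of `a b` together surround each point between `a` and `b`. -/
theorem closedTriangle_union_mem_nhds {a b c d q : Plane} (hc : 0 < orient a b c)
    (hd : 0 < orient b a d) (h1 : orient a b q = 0) (h2 : 0 < orient b c q)
    (h3 : 0 < orient c a q) : closedTriangle a b c ∪ closedTriangle b a d ∈ nhds q := by
  have h4 : 0 < orient a d q := by
    -- For `q` on the line `a b`, the ratios of `orient c a q` to `orient a b c` and of `orient a d
    -- q` to `orient b a d` are both the coordinate of `q` along `a b`.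
    have : orient a b c * orient a d q = orient c a q * orient b a d := by
      unfold orient at h1 ⊢
      linear_combination (-1 : ℝ) * ((c 0 - a 0) * (d 1 - a 1) - (c 1 - a 1) * (d 0 - a 0)) * h1
    exact (mul_pos_iff_of_pos_left hc).1 (this ▸ mul_pos h3 hd)
  have h5 : 0 < orient d b q := by
    have : orient a b c * orient d b q = orient b c q * orient b a d := by
      unfold orient at h1 ⊢
      linear_combination ((b 0 - d 0) * (c 1 - b 1) - (b 1 - d 1) * (c 0 - b 0)) * h1
    exact (mul_pos_iff_of_pos_left hc).1 (this ▸ mul_pos h2 hd)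
  filter_upwards [(continuous_orient b c).continuousAt.eventually_const_lt h2,
    (continuous_orient c a).continuousAt.eventually_const_lt h3,
    (continuous_orient a d).continuousAt.eventually_const_lt h4,
    (continuous_orient d b).continuousAt.eventually_const_lt h5] with x h2 h3 h4 h5
  rcases le_total 0 (orient a b x) with h | h
  · exact Or.inl ⟨h, h2.le, h3.le⟩
  · exact Or.inr ⟨by rw [orient_swap]; linarith, h4.le, h5.le⟩

/-! ### Triangulated polygons -/

namespace Polygon

variable {n : ℕ}

theorem boundary_eq_iUnion_segment [NeZero n] (P : Polygon Plane n) :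
    P.boundary ℝ = ⋃ i, segment ℝ (P i) (P (i + 1)) := by
  simp only [boundary, edgeSet, finRotate_apply, affineSegment_eq_segment]

/-- `(a, b)` is a directed side of one of the triangles of `T`, with third vertex `c`. -/
def IsSide (T : List (Fin n × Fin n × Fin n)) (a b c : Fin n) : Prop :=
  (a, b, c) ∈ T ∨ (b, c, a) ∈ T ∨ (c, a, b) ∈ T

instance (T : List (Fin n × Fin n × Fin n)) (a b c : Fin n) : Decidable (IsSide T a b c) :=
  inferInstanceAs (Decidable (_ ∨ _))

theorem IsSide.rotate {T : List (Fin n × Fin n × Fin n)} {a b c : Fin n} (h : IsSide T a b c) :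
    IsSide T b c a := by
  unfold IsSide at *; tauto

/-- Every directed side of a triangle of `T` is a directed edge of the polygon or a side of another
triangle of `T` with the opposite direction. -/
def SidesMatch [NeZero n] (T : List (Fin n × Fin n × Fin n)) : Prop :=
  ∀ t ∈ T, (t.2.1 = t.1 + 1 ∨ ∃ d, IsSide T t.2.1 t.1 d) ∧
    (t.2.2 = t.2.1 + 1 ∨ ∃ d, IsSide T t.2.2 t.2.1 d) ∧
    (t.1 = t.2.2 + 1 ∨ ∃ d, IsSide T t.1 t.2.2 d)

instance [NeZero n] (T : List (Fin n × Fin n × Fin n)) : Decidable (SidesMatch T) :=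
  inferInstanceAs (Decidable (∀ _ ∈ T, _))

/-- `T` lists counterclockwise triangles with vertices among those of `P`, glued along all their
sides which are not edges of `P`. -/
structure IsTriangulation [NeZero n] (P : Polygon Plane n) (T : List (Fin n × Fin n × Fin n)) :
    Prop where
  pos : ∀ t ∈ T, 0 < orient (P t.1) (P t.2.1) (P t.2.2)
  sides : SidesMatch T

/-- The union of the triangles of `T`. -/
def triangles (P : Polygon Plane n) (T : List (Fin n × Fin n × Fin n)) : Set Plane :=
  ⋃ t ∈ {t | t ∈ T}, closedTriangle (P t.1) (P t.2.1) (P t.2.2)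

theorem isClosed_triangles (P : Polygon Plane n) (T : List (Fin n × Fin n × Fin n)) :
    IsClosed (P.triangles T) :=
  (List.finite_toSet T).isClosed_biUnion fun _ _ => isClosed_closedTriangle _ _ _

theorem IsSide.closedTriangle_subset {P : Polygon Plane n}
    {T : List (Fin n × Fin n × Fin n)} {a b c : Fin n} (h : IsSide T a b c) :
    closedTriangle (P a) (P b) (P c) ⊆ P.triangles T := by
  have key : ∀ t ∈ T, closedTriangle (P t.1) (P t.2.1) (P t.2.2) ⊆ P.triangles T :=
    fun t ht _ hx => Set.mem_iUnion₂.2 ⟨t, ht, hx⟩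
  rcases h with h | h | h
  · exact key _ h
  · rw [← closedTriangle_rotate]
    exact key _ h
  · rw [closedTriangle_rotate (P c)]
    exact key _ h

variable [NeZero n] {P : Polygon Plane n} {T : List (Fin n × Fin n × Fin n)}

theorem mem_boundary (P : Polygon Plane n) (i : Fin n) : P i ∈ P.boundary ℝ := by
  rw [boundary_eq_iUnion_segment]
  exact Set.mem_iUnion.2 ⟨i, left_mem_segment ℝ _ _⟩

theorem IsTriangulation.isBounded_triangles (h : P.IsTriangulation T) :
    Bornology.IsBounded (P.triangles T) :=
  (Bornology.isBounded_biUnion (List.finite_toSet T)).2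
    fun t ht => isBounded_closedTriangle (h.pos t ht)

namespace IsTriangulation

theorem orient_pos (h : P.IsTriangulation T) {a b c : Fin n} (hs : IsSide T a b c) :
    0 < orient (P a) (P b) (P c) := by
  rcases hs with hs | hs | hs
  · exact h.pos _ hs
  · rw [← orient_rotate]; exact h.pos _ hs
  · rw [orient_rotate (P c)]; exact h.pos _ hs

theorem eq_add_one_or_exists (h : P.IsTriangulation T) {a b c : Fin n} (hs : IsSide T a b c) :
    b = a + 1 ∨ ∃ d, IsSide T b a d := by
  rcases hs with hs | hs | hs
  · exact (h.sides _ hs).1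
  · exact (h.sides _ hs).2.2
  · exact (h.sides _ hs).2.1

/-- Off the boundary, `q` is not a vertex and its side is not an edge, so a second triangle is glued
on along the reversed side. The two triangles surround `q`. -/
theorem mem_nhds_of_orient_eq_zero (h : P.IsTriangulation T) {a b c : Fin n}
    (hs : IsSide T a b c) {q : Plane} (hq : q ∉ P.boundary ℝ)
    (hmem : q ∈ closedTriangle (P a) (P b) (P c)) (h0 : orient (P a) (P b) q = 0) :
    P.triangles T ∈ nhds q := by
  have hpos := h.orient_pos hs
  have hseg := mem_segment_of_orient hpos h0 hmem.2.1 hmem.2.2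
  rcases h.eq_add_one_or_exists hs with rfl | ⟨d, hd⟩
  · refine absurd ?_ hq
    rw [boundary_eq_iUnion_segment]
    exact Set.mem_iUnion.2 ⟨a, hseg⟩
  · obtain ⟨s, t, hs0, ht0, hst, rfl⟩ := hseg
    have e1 : orient (P b) (P c) (s • P a + t • P b) = s * orient (P a) (P b) (P c) := by
      rw [orient_combo _ _ _ _ hst, orient_rotate (P a), orient_self_left]; ring
    have e2 : orient (P c) (P a) (s • P a + t • P b) = t * orient (P a) (P b) (P c) := by
      rw [orient_combo _ _ _ _ hst, orient_self_right, orient_rotate (P b) (P c) (P a),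
        orient_rotate (P a)]; ring
    have hs1 : 0 < s := by
      refine lt_of_le_of_ne hs0 fun hs1 => hq ?_
      subst hs1
      obtain rfl : t = 1 := by linarith
      simpa using P.mem_boundary b
    have ht1 : 0 < t := by
      refine lt_of_le_of_ne ht0 fun ht1 => hq ?_
      subst ht1
      obtain rfl : s = 1 := by linarith
      simpa using P.mem_boundary a
    exact Filter.mem_of_superset
      (closedTriangle_union_mem_nhds hpos (h.orient_pos hd) h0 (e1 ▸ mul_pos hs1 hpos)
        (e2 ▸ mul_pos ht1 hpos))
      (Set.union_subset hs.closedTriangle_subset hd.closedTriangle_subset)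

theorem triangles_mem_nhds (h : P.IsTriangulation T) {q : Plane} (hq : q ∉ P.boundary ℝ)
    (hmem : q ∈ P.triangles T) : P.triangles T ∈ nhds q := by
  obtain ⟨⟨a, b, c⟩, ht, hm⟩ := Set.mem_iUnion₂.1 hmem
  have hs : IsSide T a b c := Or.inl ht
  rcases hm.1.eq_or_lt with h1 | h1
  · exact h.mem_nhds_of_orient_eq_zero hs hq hm h1.symm
  rcases hm.2.1.eq_or_lt with h2 | h2
  · exact h.mem_nhds_of_orient_eq_zero hs.rotate hq (closedTriangle_rotate (P a) _ _ ▸ hm) h2.symm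
  rcases hm.2.2.eq_or_lt with h3 | h3
  · exact h.mem_nhds_of_orient_eq_zero hs.rotate.rotate hq
      (closedTriangle_rotate (P c) (P a) (P b) ▸ hm) h3.symm
  exact Filter.mem_of_superset (closedTriangle_mem_nhds h1 h2 h3) hs.closedTriangle_subset

/-- Off the boundary the union of the triangles is both closed and open, and a preconnected set
cannot be split by it. -/
theorem subset_triangles (h : P.IsTriangulation T) {s : Set Plane} (hs : IsPreconnected s)
    (hb : Disjoint s (P.boundary ℝ)) (hT : (s ∩ P.triangles T).Nonempty) :
    s ⊆ P.triangles T := by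
  have hsub : s ∩ P.triangles T ⊆ interior (P.triangles T) := fun x hx =>
    mem_interior_iff_mem_nhds.2 (h.triangles_mem_nhds (Set.disjoint_left.1 hb hx.1) hx.2)
  refine (hs.subset_left_of_subset_union isOpen_interior
    (isClosed_triangles P T).isOpen_compl
    (disjoint_compl_right.mono_left interior_subset) (fun x hx => ?_) ?_).trans interior_subset
  · by_cases hxT : x ∈ P.triangles T
    · exact Or.inl (hsub ⟨hx, hxT⟩)
    · exact Or.inr hxT
  · obtain ⟨x, hx⟩ := hT
    exact ⟨x, hx.1, hsub hx⟩

theorem mem_inside (h : P.IsTriangulation T) {x : Plane} (hb : x ∉ P.boundary ℝ)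
    (hT : x ∈ P.triangles T) : x ∈ P.inside := by
  refine ⟨hb, h.isBounded_triangles.subset (h.subset_triangles
    isPreconnected_connectedComponentIn ?_ ⟨x, mem_connectedComponentIn hb, hT⟩)⟩
  exact Set.disjoint_left.2 fun y hy => connectedComponentIn_subset _ _ hy

theorem subset_inside (h : P.IsTriangulation T) {s : Set Plane} (hs : IsPreconnected s)
    (hb : Disjoint s (P.boundary ℝ)) (hT : (s ∩ P.triangles T).Nonempty) :
    s ⊆ P.inside := fun _ hx =>
  h.mem_inside (Set.disjoint_left.1 hb hx) (h.subset_triangles hs hb hT hx)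

end IsTriangulation

end Polygon

/-! ### Lattice points -/

/-- The lattice point `p` as a point of the plane. -/
noncomputable def toPlane (p : ℤ × ℤ) : Plane := !₂[(p.1 : ℝ), (p.2 : ℝ)]

@[simp] theorem toPlane_zero (p : ℤ × ℤ) : toPlane p 0 = p.1 := rfl

@[simp] theorem toPlane_one (p : ℤ × ℤ) : toPlane p 1 = p.2 := rfl

theorem toPlane_injective : Function.Injective toPlane := by
  intro p q h
  have h0 := congrArg (fun v : Plane => v 0) h
  have h1 := congrArg (fun v : Plane => v 1) h
  simp only [toPlane_zero, toPlane_one, Int.cast_inj] at h0 h1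
  exact Prod.ext h0 h1

/-- Twice the signed area of a lattice triangle. -/
def latOrient (a b c : ℤ × ℤ) : ℤ :=
  (b.1 - a.1) * (c.2 - a.2) - (b.2 - a.2) * (c.1 - a.1)

theorem orient_toPlane (a b c : ℤ × ℤ) :
    orient (toPlane a) (toPlane b) (toPlane c) = latOrient a b c := by
  simp [orient, latOrient]

/-- The lattice point `p` scaled by `16`. -/
def scaled (p : ℤ × ℤ) : ℤ × ℤ := (16 * p.1, 16 * p.2)

/-- The point which divides the segment from `scaled a` to `scaled b` in the ratio
`k : 16 - k`. -/
def divide (k : ℤ) (a b : ℤ × ℤ) : ℤ × ℤ :=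
  ((16 - k) * a.1 + k * b.1, (16 - k) * a.2 + k * b.2)

theorem toPlane_divide_mem {k : ℤ} (h0 : 0 < k) (h1 : k < 16) (a b : ℤ × ℤ) :
    toPlane (divide k a b) ∈ openSegment ℝ (toPlane (scaled a)) (toPlane (scaled b)) := by
  have h0' : (0 : ℝ) < k := by exact_mod_cast h0
  have h1' : (k : ℝ) < 16 := by exact_mod_cast h1
  refine ⟨(16 - k) / 16, k / 16, by linarith, by linarith, by ring, ?_⟩
  refine Plane.ext_coord ?_ ?_ <;>
  · simp only [PiLp.add_apply, PiLp.smul_apply, smul_eq_mul, toPlane_zero, toPlane_one, scaled,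
      divide]
    push_cast
    ring

/-- The open segment `p q` and the closed segment `u w` are separated by the line through one of
them. -/
def Apart (p q u w : ℤ × ℤ) : Prop :=
  (0 < latOrient p q u ∧ 0 < latOrient p q w) ∨ (latOrient p q u < 0 ∧ latOrient p q w < 0) ∨
  (0 ≤ latOrient u w p ∧ 0 ≤ latOrient u w q ∧ 0 < latOrient u w p + latOrient u w q) ∨
  (latOrient u w p ≤ 0 ∧ latOrient u w q ≤ 0 ∧ latOrient u w p + latOrient u w q < 0)

instance (p q u w : ℤ × ℤ) : Decidable (Apart p q u w) :=
  inferInstanceAs (Decidable (_ ∨ _))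

theorem orient_eq_zero_of_mem_segment {p q z : Plane} (h : z ∈ segment ℝ p q) :
    orient p q z = 0 := by
  obtain ⟨s, t, -, -, hst, rfl⟩ := h
  rw [orient_combo _ _ _ _ hst, orient_self_left, orient_self_right]; ring

/-- A common point would have orientation zero with respect to both lines. Weak signs with a nonzero
sum suffice for the endpoints `p`, `q`, because points of an open segment have positive weights at
both; this admits segments that share an endpoint. -/
theorem Apart.disjoint {p q u w : ℤ × ℤ} (h : Apart p q u w) :
    Disjoint (openSegment ℝ (toPlane p) (toPlane q)) (segment ℝ (toPlane u) (toPlane w)) := by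
  refine Set.disjoint_left.2 fun z hz hz' => ?_
  have e1 := orient_eq_zero_of_mem_segment (openSegment_subset_segment ℝ _ _ hz)
  have e2 := orient_eq_zero_of_mem_segment hz'
  obtain ⟨s, t, hs, ht, hst, rfl⟩ := hz
  obtain ⟨s', t', hs', ht', hst', he⟩ := hz'
  rw [← he, orient_combo _ _ _ _ hst', orient_toPlane, orient_toPlane] at e1
  rw [orient_combo _ _ _ _ hst, orient_toPlane, orient_toPlane] at e2
  rcases h with ⟨h1, h2⟩ | ⟨h1, h2⟩ | ⟨h1, h2, h3⟩ | ⟨h1, h2, h3⟩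
  · have h1' : (0 : ℝ) < latOrient p q u := by exact_mod_cast h1
    have h2' : (0 : ℝ) < latOrient p q w := by exact_mod_cast h2
    rcases hs'.eq_or_lt with rfl | hs'
    · rw [show t' = 1 by linarith] at e1; linarith
    · linarith [mul_pos hs' h1', mul_nonneg ht' h2'.le]
  · have h1' : (latOrient p q u : ℝ) < 0 := by exact_mod_cast h1
    have h2' : (latOrient p q w : ℝ) < 0 := by exact_mod_cast h2
    rcases hs'.eq_or_lt with rfl | hs'
    · rw [show t' = 1 by linarith] at e1; linarith
    · linarith [mul_neg_of_pos_of_neg hs' h1', mul_nonpos_of_nonneg_of_nonpos ht' h2'.le]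
  · have h1' : (0 : ℝ) ≤ latOrient u w p := by exact_mod_cast h1
    have h2' : (0 : ℝ) ≤ latOrient u w q := by exact_mod_cast h2
    have h3' : (0 : ℝ) < latOrient u w p + latOrient u w q := by exact_mod_cast h3
    rcases h1'.eq_or_lt with h | h
    · linarith [mul_nonneg hs.le h1', mul_pos ht (show (0 : ℝ) < latOrient u w q by linarith)]
    · linarith [mul_pos hs h, mul_nonneg ht.le h2']
  · have h1' : (latOrient u w p : ℝ) ≤ 0 := by exact_mod_cast h1
    have h2' : (latOrient u w q : ℝ) ≤ 0 := by exact_mod_cast h2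
    have h3' : (latOrient u w p + latOrient u w q : ℝ) < 0 := by exact_mod_cast h3
    rcases h1'.eq_or_lt with h | h
    · linarith [mul_nonpos_of_nonneg_of_nonpos hs.le h1',
        mul_neg_of_pos_of_neg ht (show (latOrient u w q : ℝ) < 0 by linarith)]
    · linarith [mul_neg_of_pos_of_neg hs h, mul_nonpos_of_nonneg_of_nonpos ht.le h2']

/-- Seen from `x`, the segment `u w` covers the open segment `p q`. -/
def Shields (x p q u w : ℤ × ℤ) : Prop :=
  0 < latOrient u w x ∧ latOrient u w p ≤ 0 ∧ latOrient u w q ≤ 0 ∧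
  latOrient u w p + latOrient u w q < 0 ∧ latOrient x p u ≤ 0 ∧ latOrient x q u ≤ 0 ∧
  0 ≤ latOrient x p w ∧ 0 ≤ latOrient x q w

instance (x p q u w : ℤ × ℤ) : Decidable (Shields x p q u w) :=
  inferInstanceAs (Decidable (_ ∧ _))

/-- The orientations involved are affine in the target, so the sign conditions at `p` and `q` pass
to every point between them. -/
theorem Shields.inter_nonempty {x p q u w : ℤ × ℤ} (h : Shields x p q u w) {z : Plane}
    (hz : z ∈ openSegment ℝ (toPlane p) (toPlane q)) :
    (openSegment ℝ (toPlane x) z ∩ segment ℝ (toPlane u) (toPlane w)).Nonempty := by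
  obtain ⟨h1, h2, h3, h4, h5, h6, h7, h8⟩ := h
  obtain ⟨s, t, hs, ht, hst, rfl⟩ := hz
  have h2' : (latOrient u w p : ℝ) ≤ 0 := by exact_mod_cast h2
  have h3' : (latOrient u w q : ℝ) ≤ 0 := by exact_mod_cast h3
  have h4' : (latOrient u w p + latOrient u w q : ℝ) < 0 := by exact_mod_cast h4
  apply exists_mem_openSegment_inter_segment
  · rw [orient_toPlane]; exact_mod_cast h1
  · rw [orient_combo _ _ _ _ hst, orient_toPlane, orient_toPlane]
    rcases h2'.eq_or_lt with h | h
    · linarith [mul_nonpos_of_nonneg_of_nonpos hs.le h2',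
        mul_neg_of_pos_of_neg ht (show (latOrient u w q : ℝ) < 0 by linarith)]
    · linarith [mul_neg_of_pos_of_neg hs h, mul_nonpos_of_nonneg_of_nonpos ht.le h3']
  · rw [orient_combo_mid _ _ _ _ hst, orient_toPlane, orient_toPlane]
    have h5' : (latOrient x p u : ℝ) ≤ 0 := by exact_mod_cast h5
    have h6' : (latOrient x q u : ℝ) ≤ 0 := by exact_mod_cast h6
    linarith [mul_nonpos_of_nonneg_of_nonpos hs.le h5', mul_nonpos_of_nonneg_of_nonpos ht.le h6']
  · rw [orient_combo_mid _ _ _ _ hst, orient_toPlane, orient_toPlane]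
    have h7' : (0 : ℝ) ≤ latOrient x p w := by exact_mod_cast h7
    have h8' : (0 : ℝ) ≤ latOrient x q w := by exact_mod_cast h8
    linarith [mul_nonneg hs.le h7', mul_nonneg ht.le h8']

/-! ### Lattice polygons -/

/-- The polygon whose vertices are the given lattice points, scaled by `16`. -/
noncomputable def latticePolygon {n : ℕ} (V : Fin n → ℤ × ℤ) : Polygon Plane n :=
  ⟨fun i => toPlane (scaled (V i))⟩

namespace LatticePolygon

variable {n : ℕ} [NeZero n] (V : Fin n → ℤ × ℤ)

theorem boundary_eq : (latticePolygon V).boundary ℝ =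
    ⋃ i, segment ℝ (toPlane (scaled (V i))) (toPlane (scaled (V (i + 1)))) :=
  Polygon.boundary_eq_iUnion_segment _

/-- The lattice criterion for simplicity. -/
def Simple : Prop :=
  (∀ i, latOrient (scaled (V i)) (scaled (V (i + 1))) (scaled (V (i + 2))) ≠ 0) ∧
  (∀ i j, V i = V j → i = j) ∧
  ∀ i j, i ≠ j → Apart (scaled (V i)) (scaled (V (i + 1))) (scaled (V j)) (scaled (V (j + 1)))

instance : Decidable (Simple V) := inferInstanceAs (Decidable (_ ∧ _))

variable {V}

theorem scaled_injective : Function.Injective scaled := by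
  intro p q h
  simp only [scaled, Prod.mk.injEq, mul_eq_mul_left_iff] at h
  exact Prod.ext (by simpa using h.1) (by simpa using h.2)

theorem Simple.isSimple (h : Simple V) : (latticePolygon V).IsSimple where
  corners i := affineIndependent_of_orient_ne_zero
    ((orient_toPlane _ _ _).trans_ne (Int.cast_ne_zero.2 (h.1 i)))
  injective i j hij := h.2.1 i j (scaled_injective (toPlane_injective hij))
  inter_subset i j hij := by
    -- `Apart` treats its two segments asymmetrically, so it bounds the intersection by the
    -- endpoints of the first edge only; exchanging the edges gives the other half.
    have key : ∀ i j, i ≠ j → (latticePolygon V).edgeSet ℝ i ∩ (latticePolygon V).edgeSet ℝ j ⊆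
        {(latticePolygon V) i, (latticePolygon V) (i + 1)} := by
      rintro i j hij z ⟨hi, hj⟩
      simp only [Polygon.edgeSet, finRotate_apply, affineSegment_eq_segment] at hi hj
      rw [← insert_endpoints_openSegment] at hi
      rcases hi with hi | hi | hi
      · exact Or.inl hi
      · exact Or.inr hi
      · exact absurd hj (Set.disjoint_left.1 (h.2.2 i j hij).disjoint hi)
    exact Set.subset_inter (key i j hij) (Set.inter_comm _ _ ▸ key j i hij.symm)

variable (V)

/-- The lattice criterion for a list of triangles to be a triangulation. -/
def Triangulates (T : List (Fin n × Fin n × Fin n)) : Prop :=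
  (∀ t ∈ T, 0 < latOrient (scaled (V t.1)) (scaled (V t.2.1)) (scaled (V t.2.2))) ∧
  Polygon.SidesMatch T

instance (T : List (Fin n × Fin n × Fin n)) : Decidable (Triangulates V T) :=
  inferInstanceAs (Decidable (_ ∧ _))

/-- The lattice criterion for an open segment to lie in the interior: it avoids all edges, and its
midpoint lies in a triangle. -/
def Clear (T : List (Fin n × Fin n × Fin n)) (p q : ℤ × ℤ) : Prop :=
  (∀ i, Apart p q (scaled (V i)) (scaled (V (i + 1)))) ∧
  ∃ t ∈ T,
    (0 ≤ latOrient (scaled (V t.1)) (scaled (V t.2.1)) p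
      + latOrient (scaled (V t.1)) (scaled (V t.2.1)) q) ∧
    (0 ≤ latOrient (scaled (V t.2.1)) (scaled (V t.2.2)) p
      + latOrient (scaled (V t.2.1)) (scaled (V t.2.2)) q) ∧
    (0 ≤ latOrient (scaled (V t.2.2)) (scaled (V t.1)) p
      + latOrient (scaled (V t.2.2)) (scaled (V t.1)) q)

instance (T : List (Fin n × Fin n × Fin n)) (p q : ℤ × ℤ) : Decidable (Clear V T p q) :=
  inferInstanceAs (Decidable (_ ∧ _))

/-- Two guards, given by their endpoints, which see each other along a segment between two of the
points that divide them in the ratios `8 : 8`, `1 : 15` and `15 : 1`. -/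
def Mutual (T : List (Fin n × Fin n × Fin n)) (g h : Fin n × Fin n) : Prop :=
  latOrient (scaled (V h.1)) (scaled (V h.2)) (scaled (V g.1))
    + latOrient (scaled (V h.1)) (scaled (V h.2)) (scaled (V g.2)) ≠ 0 ∧
  ∃ k ∈ [(8 : ℤ), 1, 15], ∃ l ∈ [(8 : ℤ), 1, 15],
    Clear V T (divide k (V g.1) (V g.2)) (divide l (V h.1) (V h.2))

instance (T : List (Fin n × Fin n × Fin n)) (g h : Fin n × Fin n) : Decidable (Mutual V T g h) :=
  inferInstanceAs (Decidable (_ ∧ _))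

/-- Seen from `x`, the open segment `p q` is covered by a single edge. -/
def Shielded (x p q : ℤ × ℤ) : Prop :=
  ∃ i, Shields x p q (scaled (V i)) (scaled (V (i + 1))) ∨
    Shields x p q (scaled (V (i + 1))) (scaled (V i))

instance (x p q : ℤ × ℤ) : Decidable (Shielded V x p q) :=
  inferInstanceAs (Decidable (∃ _, _))

/-- Seen from `x`, the guard `g` is covered by one edge or by two. -/
def Invisible (x : ℤ × ℤ) (g : Fin n × Fin n) : Prop :=
  Shielded V x (scaled (V g.1)) (scaled (V g.2)) ∨
  ∃ k ∈ [(8 : ℤ), 15, 13, 9, 3, 5, 10],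
    Shielded V x (scaled (V g.1)) (divide k (V g.1) (V g.2)) ∧
    Shielded V x (divide k (V g.1) (V g.2)) (divide k (V g.1) (V g.2)) ∧
    Shielded V x (divide k (V g.1) (V g.2)) (scaled (V g.2))

instance (x : ℤ × ℤ) (g : Fin n × Fin n) : Decidable (Invisible V x g) :=
  inferInstanceAs (Decidable (_ ∨ _))

/-- The segment between the endpoints of `g` is not an edge and properly crosses an edge. -/
def Crossed (g : Fin n × Fin n) : Prop :=
  g.2 ≠ g.1 + 1 ∧ g.1 ≠ g.2 + 1 ∧
  ∃ i, Shields (scaled (V g.1)) (scaled (V g.2)) (scaled (V g.2)) (scaled (V i))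
      (scaled (V (i + 1))) ∨
    Shields (scaled (V g.1)) (scaled (V g.2)) (scaled (V g.2)) (scaled (V (i + 1)))
      (scaled (V i))

instance (g : Fin n × Fin n) : Decidable (Crossed V g) :=
  inferInstanceAs (Decidable (_ ∧ _))

/-- The lattice criterion for `w` to be an interior point which is seen only by guards with
endpoints in `G`. -/
def SeenOnlyBy (T : List (Fin n × Fin n × Fin n)) (w : ℤ × ℤ) (G : List (Fin n × Fin n)) : Prop :=
  Clear V T w w ∧ ∀ i j, i < j → (i, j) ∈ G ∨ Crossed V (i, j) ∨ Invisible V w (i, j)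

instance (T : List (Fin n × Fin n × Fin n)) (w : ℤ × ℤ) (G : List (Fin n × Fin n)) :
    Decidable (SeenOnlyBy V T w G) :=
  inferInstanceAs (Decidable (_ ∧ _))

variable {V} {T : List (Fin n × Fin n × Fin n)}

theorem Triangulates.isTriangulation (h : Triangulates V T) :
    (latticePolygon V).IsTriangulation T where
  pos t ht := (orient_toPlane _ _ _).symm ▸ Int.cast_pos.2 (h.1 t ht)
  sides := h.2

theorem Clear.subset_inside (hT : Triangulates V T) {p q : ℤ × ℤ} (h : Clear V T p q) :
    openSegment ℝ (toPlane p) (toPlane q) ⊆ (latticePolygon V).inside := by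
  refine hT.isTriangulation.subset_inside (convex_openSegment _ _).isPreconnected ?_ ?_
  · rw [boundary_eq, Set.disjoint_iUnion_right]
    exact fun i => (h.1 i).disjoint
  · obtain ⟨t, ht, h1, h2, h3⟩ := h.2
    have key : ∀ {a b : ℤ × ℤ}, 0 ≤ latOrient a b p + latOrient a b q →
        0 ≤ orient (toPlane a) (toPlane b) ((2 : ℝ)⁻¹ • toPlane p + (2 : ℝ)⁻¹ • toPlane q) := by
      intro a b hab
      rw [orient_combo _ _ _ _ (by norm_num), orient_toPlane, orient_toPlane]
      have : (0 : ℝ) ≤ latOrient a b p + latOrient a b q := by exact_mod_cast hab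
      linarith
    exact ⟨_, ⟨2⁻¹, 2⁻¹, by norm_num, by norm_num, by norm_num, rfl⟩,
      Set.mem_iUnion₂.2 ⟨t, ht, key h1, key h2, key h3⟩⟩

/-- The open segment between the vertices with indices `g.1` and `g.2`. -/
def guard (V : Fin n → ℤ × ℤ) (g : Fin n × Fin n) : Set Plane :=
  openSegment ℝ (toPlane (scaled (V g.1))) (toPlane (scaled (V g.2)))

theorem Mutual.seeEachOther (hT : Triangulates V T) {g h : Fin n × Fin n} (H : Mutual V T g h) :
    (latticePolygon V).SeeEachOther (guard V g) (guard V h) := by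
  obtain ⟨-, k, hk, l, hl, hc⟩ := H
  have range : ∀ m ∈ [(8 : ℤ), 1, 15], 0 < m ∧ m < 16 := by decide
  refine ⟨_, toPlane_divide_mem (range k hk).1 (range k hk).2 _ _, _,
    toPlane_divide_mem (range l hl).1 (range l hl).2 _ _, ?_⟩
  rintro z ⟨hz, hne⟩
  rw [← insert_endpoints_openSegment] at hz
  simp only [Set.mem_insert_iff, Set.mem_singleton_iff, not_or] at hz hne
  exact hc.subset_inside hT ((hz.resolve_left hne.1).resolve_left hne.2)

/-- The first condition in `Mutual` says that the midpoint of `g` is off the line through `h`.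
Hiddenness constrains only guards that differ as sets, so distinct index pairs would not be enough.
-/
theorem Mutual.guard_ne {g h : Fin n × Fin n} (H : Mutual V T g h) : guard V g ≠ guard V h := by
  intro he
  have hm : (2 : ℝ)⁻¹ • toPlane (scaled (V g.1)) + (2 : ℝ)⁻¹ • toPlane (scaled (V g.2))
      ∈ guard V g := ⟨2⁻¹, 2⁻¹, by norm_num, by norm_num, by norm_num, rfl⟩
  rw [he] at hm
  have h0 := orient_eq_zero_of_mem_segment (openSegment_subset_segment ℝ _ _ hm)
  rw [orient_combo _ _ _ _ (by norm_num), orient_toPlane, orient_toPlane] at h0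
  refine H.1 ?_
  have : (latOrient (scaled (V h.1)) (scaled (V h.2)) (scaled (V g.1))
    + latOrient (scaled (V h.1)) (scaled (V h.2)) (scaled (V g.2)) : ℝ) = 0 := by linarith
  exact_mod_cast this

theorem Shields.not_subset_inside {x p q : ℤ × ℤ} {i : Fin n}
    (h : Shields x p q (scaled (V i)) (scaled (V (i + 1))) ∨
      Shields x p q (scaled (V (i + 1))) (scaled (V i))) {z : Plane}
    (hz : z ∈ openSegment ℝ (toPlane p) (toPlane q)) :
    ¬ openSegment ℝ (toPlane x) z ⊆ (latticePolygon V).inside := by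
  intro hsub
  obtain ⟨y, hy, hy'⟩ : (openSegment ℝ (toPlane x) z ∩
      segment ℝ (toPlane (scaled (V i))) (toPlane (scaled (V (i + 1))))).Nonempty := by
    rcases h with h | h
    · exact h.inter_nonempty hz
    · rw [segment_symm]; exact h.inter_nonempty hz
  refine (hsub hy).1 ?_
  rw [boundary_eq]
  exact Set.mem_iUnion.2 ⟨i, hy'⟩

theorem Invisible.not_sees {x : ℤ × ℤ} {g : Fin n × Fin n} (h : Invisible V x g) :
    ¬ (latticePolygon V).Sees (guard V g) (toPlane x) := by
  rintro ⟨z, hz, hsub⟩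
  rcases h with ⟨i, h⟩ | ⟨k, hk, ⟨i, h1⟩, ⟨j, h2⟩, ⟨l, h3⟩⟩
  · exact Shields.not_subset_inside h hz hsub
  · have range : ∀ m ∈ [(8 : ℤ), 15, 13, 9, 3, 5, 10], 0 < m ∧ m < 16 := by decide
    have hm := toPlane_divide_mem (range k hk).1 (range k hk).2 (V g.1) (V g.2)
    rw [openSegment_eq_image_lineMap] at hm
    -- The target is the dividing point or lies in one of the two open pieces; each case has its own
    -- covering edge.
    rcases openSegment_subset_union _ _ (Set.image_subset_range _ _ hm) hz with hz | hz | hz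
    · refine Shields.not_subset_inside h2 ?_ hsub
      rw [openSegment_same]; exact hz
    · exact Shields.not_subset_inside h1 hz hsub
    · exact Shields.not_subset_inside h3 hz hsub

theorem Crossed.not_subset_inside {g : Fin n × Fin n} (h : Crossed V g) :
    ¬ guard V g ⊆ (latticePolygon V).inside := by
  obtain ⟨-, -, i, h⟩ := h
  exact Shields.not_subset_inside h (by rw [openSegment_same]; rfl)

/-- Sorting the endpoints leaves only pairs `i < j` to test. Indices are cyclic, so the closing edge
becomes `(0, n - 1)`, which is why `i = j + 1` must be allowed. -/
theorem exists_guard_eq (hV : Simple V) {s : Set Plane}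
    (hs : (latticePolygon V).IsOpenMobileGuard s) : ∃ i j, i < j ∧ s = guard V (i, j) ∧
      (j = i + 1 ∨ i = j + 1 ∨ s ⊆ (latticePolygon V).inside) := by
  obtain ⟨i, j, hij, h1, h2⟩ : ∃ i j, i ≠ j ∧ s = guard V (i, j) ∧
      (j = i + 1 ∨ i = j + 1 ∨ s ⊆ (latticePolygon V).inside) := by
    rcases hs with ⟨i, rfl⟩ | ⟨i, j, hij, -, -, rfl, h⟩
    · refine ⟨i, i + 1, fun h => ?_, rfl, Or.inl rfl⟩
      have := hV.isSimple.corners.hasNondegenerateEdges i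
      rw [finRotate_apply] at this
      exact this (congrArg _ h)
    · exact ⟨i, j, hij, rfl, Or.inr (Or.inr h)⟩
  rcases hij.lt_or_gt with h | h
  · exact ⟨i, j, h, h1, h2⟩
  · exact ⟨j, i, h, h1.trans (openSegment_symm ℝ _ _), by tauto⟩

theorem SeenOnlyBy.exists_mem (hV : Simple V) {w : ℤ × ℤ} {G : List (Fin n × Fin n)}
    (h : SeenOnlyBy V T w G) {s : Set Plane} (hs : (latticePolygon V).IsOpenMobileGuard s)
    (hw : (latticePolygon V).Sees s (toPlane w)) : ∃ g ∈ G, s = guard V g := by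
  obtain ⟨i, j, hij, rfl, hc⟩ := exists_guard_eq hV hs
  rcases h.2 i j hij with hG | hX | hI
  · exact ⟨_, hG, rfl⟩
  · rcases hc with hc | hc | hc
    · exact absurd hc hX.1
    · exact absurd hc hX.2.1
    · exact absurd hc hX.not_subset_inside
  · exact absurd hw hI.not_sees

theorem SeenOnlyBy.mem_inside (hT : Triangulates V T) {w : ℤ × ℤ} {G : List (Fin n × Fin n)}
    -- The segment tested by `Clear V T w w` is degenerate, so the test amounts to a statement about
    -- the point `w` itself.
    (h : SeenOnlyBy V T w G) : toPlane w ∈ (latticePolygon V).inside :=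
  h.1.subset_inside hT (by rw [openSegment_same]; rfl)

variable (V T) in
/-- Whether every way to add to the guards of `C` a guard out of each list runs into two guards
which see each other. -/
def refutes : List (List (Fin n × Fin n)) → List (Fin n × Fin n) → Bool
  | [], _ => false
  | G :: Gs, C =>
    if ∃ g ∈ C, g ∈ G then refutes Gs C
    else G.all fun g => decide (∃ h ∈ C, Mutual V T h g) || refutes Gs (g :: C)

/-- `I` stands for membership in a hidden guard set. Following a member satisfying `I` down the
search tree keeps all of `C` in `I`, so no conflict can close that branch, and it ends at the empty
list with the value `false`. A list already met by `C` imposes nothing new. -/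
theorem refutes_sound {I : Fin n × Fin n → Prop} (hI : ∀ g h, I g → I h → ¬ Mutual V T g h) :
    ∀ (Gs : List (List (Fin n × Fin n))) (C : List (Fin n × Fin n)),
      (∀ G ∈ Gs, ∃ g ∈ G, I g) → (∀ g ∈ C, I g) → refutes V T Gs C ≠ true
  | [], C, _, _ => by simp [refutes]
  | G :: Gs, C, hG, hC => by
    have hGs : ∀ G ∈ Gs, ∃ g ∈ G, I g := fun G' h => hG G' (List.mem_cons_of_mem _ h)
    rw [refutes]
    split
    · exact refutes_sound hI Gs C hGs hC
    · intro h
      obtain ⟨g, hg, hIg⟩ := hG G List.mem_cons_self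
      rcases Bool.or_eq_true_iff.1 (List.all_eq_true.1 h g hg) with h | h
      · obtain ⟨g', hg', hm⟩ := of_decide_eq_true h
        exact hI _ _ (hC _ hg') hIg hm
      · exact refutes_sound hI Gs (g :: C) hGs (List.forall_mem_cons.2 ⟨hIg, hC⟩) h

theorem not_isHiddenOpenMobileGuardSet (hV : Simple V) (hT : Triangulates V T)
    {W : List ((ℤ × ℤ) × List (Fin n × Fin n))} (hW : ∀ w ∈ W, SeenOnlyBy V T w.1 w.2)
    (hr : refutes V T (W.map Prod.snd) [] = true) (S : Set (Set Plane)) :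
    ¬ (latticePolygon V).IsHiddenOpenMobileGuardSet S := by
  intro hS
  refine refutes_sound (I := fun g => guard V g ∈ S) (fun g h hg hh H => ?_) _ _ ?_ (by simp) hr
  · exact hS.hidden _ hg _ hh H.guard_ne (H.seeEachOther hT)
  · intro G hG
    obtain ⟨w, hw, rfl⟩ := List.mem_map.1 hG
    obtain ⟨s, hs, hsee⟩ := hS.covers _ ((hW w hw).mem_inside hT)
    obtain ⟨g, hg, rfl⟩ := (hW w hw).exists_mem hV (hS.guards s hs) hsee
    exact ⟨g, hg, hs⟩

end LatticePolygon

/-! ### A polygon without hidden open mobile guard set -/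

/-- The vertices of a polygon without hidden open mobile guard set: a convex nonagon on six of
whose sides narrow spikes have been erected. -/
def spikyNonagon : Fin 15 → ℤ × ℤ :=
  ![(-3, -10), (6, -3), (5, -13), (9, 4), (13, 12), (10, 7), (3, 9), (13, 18), (-4, 5), (-12, 1),
    (-7, 3), (-9, -6), (-18, -5), (-5, -9), (-1, -13)]

/-- A triangulation of the polygon `spikyNonagon`. -/
def spikyNonagonTriangles : List (Fin 15 × Fin 15 × Fin 15) :=
  [(1, 2, 3), (0, 1, 3), (3, 4, 5), (0, 3, 5), (0, 5, 6), (6, 7, 8), (0, 6, 8), (8, 9, 10),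
    (0, 8, 10), (0, 10, 11), (11, 12, 13), (0, 11, 13), (0, 13, 14)]

/-- A point close to the tip of each spike of `spikyNonagon`, with the guards that see it. -/
def spikyNonagonTips : List ((ℤ × ℤ) × List (Fin 15 × Fin 15)) :=
  [((85, -181), [(0, 3), (0, 5), (1, 2), (1, 3), (1, 5), (2, 3), (3, 6), (3, 8), (3, 10), (3, 11),
      (3, 13), (5, 6), (5, 8), (5, 10), (5, 11), (5, 13)]),
    ((201, 179), [(0, 1), (0, 3), (1, 5), (1, 6), (1, 8), (1, 10), (1, 11), (1, 13), (3, 4), (3, 5),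
      (3, 6), (3, 8), (3, 10), (3, 11), (3, 13), (4, 5)]),
    ((181, 266), [(0, 8), (0, 10), (1, 8), (1, 10), (3, 8), (3, 10), (5, 8), (5, 10), (6, 7),
      (6, 8), (6, 10), (7, 8), (8, 11), (8, 13), (10, 11), (10, 13)]),
    ((-179, 22), [(0, 6), (0, 8), (1, 6), (1, 8), (3, 6), (3, 8), (5, 6), (5, 8), (6, 10), (6, 11),
      (6, 13), (8, 9), (8, 10), (8, 11), (8, 13), (9, 10)]),
    ((-266, -85), [(0, 1), (0, 3), (0, 5), (0, 6), (0, 8), (0, 10), (0, 11), (1, 13), (3, 13),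
      (5, 13), (6, 13), (8, 13), (10, 13), (11, 12), (11, 13), (12, 13)]),
    ((-22, -201), [(0, 11), (0, 13), (0, 14), (1, 11), (1, 13), (3, 11), (3, 13), (5, 11), (5, 13),
      (6, 11), (6, 13), (8, 11), (8, 13), (10, 11), (10, 13), (13, 14)])]

theorem simple_spikyNonagon : LatticePolygon.Simple spikyNonagon := by decide +kernel

theorem triangulates_spikyNonagon : LatticePolygon.Triangulates spikyNonagon spikyNonagonTriangles := by
  decide +kernel

theorem seenOnlyBy_spikyNonagonTips : ∀ w ∈ spikyNonagonTips,
    LatticePolygon.SeenOnlyBy spikyNonagon spikyNonagonTriangles w.1 w.2 := by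
  decide +kernel

theorem refutes_spikyNonagonTips :
    LatticePolygon.refutes spikyNonagon spikyNonagonTriangles (spikyNonagonTips.map Prod.snd) [] = true := by
  decide +kernel

theorem mainTheorem4 :
    ∃ (n : ℕ) (_ : NeZero n) (P : Polygon Plane n),
      P.IsSimple ∧ ¬ ∃ S : Set (Set Plane), P.IsHiddenOpenMobileGuardSet S :=
  ⟨15, inferInstance, latticePolygon spikyNonagon, simple_spikyNonagon.isSimple,
    fun ⟨S, hS⟩ => LatticePolygon.not_isHiddenOpenMobileGuardSet simple_spikyNonagon
      triangulates_spikyNonagon seenOnlyBy_spikyNonagonTips refutes_spikyNonagonTips S hS⟩
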